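/- Let $[k]=\{1,\dots,k\}$. A set $A\subseteq[k]$ separates $B\subseteq[k]$ if $A\cap B\neq\emptyset$ and $A^c\cap B\neq\emptyset$. A collection $B_1,\dots,B_n\subseteq[k]$ is separable if $|B_i|\ge 2$ for all $i$ and some single set $A\subseteq[k]$ separates every $B_i$. A family $\mathcal F\subseteq\mathscr P([k])$ is $n$-separating if for every separable collection $B_1,\dots,B_n\subseteq[k]$ there is a single $A\in\mathcal F$ that separates every $B_i$. Theorem. The minimum size of an $n$-separating family on $[k]$ is $\Omega(2^n\log k)$. That is, there is an absolute constant $c>0$ such that for all integers $n\ge 1$ and $k\ge 2n$, the minimum size of an $n$-separating family on $[k]$ (equivalently, the size of every such family) is at least $c\,2^n\log_2 k$. -/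

import Mathlib

/-- `A` separates `B` when both `A ∩ B` and `Aᶜ ∩ B` are nonempty; the ground set is `Fin k`. -/
def Separates {k : ℕ} (A B : Finset (Fin k)) : Prop :=
  (A ∩ B).Nonempty ∧ (Aᶜ ∩ B).Nonempty

/-- A collection `B₁, …, Bₙ` (repetitions allowed) is separable when every `Bᵢ` has at least two
elements and a single set separates all of them. -/
def Separable {n k : ℕ} (B : Fin n → Finset (Fin k)) : Prop :=
  (∀ i, 2 ≤ (B i).card) ∧ ∃ A : Finset (Fin k), ∀ i, Separates A (B i)

/-- A family is `n`-separating when every separable collection of `n` sets is separated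
simultaneously by a single member of the family. -/
def IsNSeparating (n : ℕ) {k : ℕ} (F : Finset (Finset (Fin k))) : Prop :=
  ∀ B : Fin n → Finset (Fin k), Separable B → ∃ A ∈ F, ∀ i, Separates A (B i)

/-- The minimum size of an `n`-separating family on a set of size `k`. It is a true minimum, see
`exists_card_eq_minSepSize` and `minSepSize_le_card`. -/
noncomputable def minSepSize (n k : ℕ) : ℕ :=
  sInf {m : ℕ | ∃ F : Finset (Finset (Fin k)), IsNSeparating n F ∧ F.card = m}

theorem exists_card_eq_minSepSize (n k : ℕ) :
    ∃ F : Finset (Finset (Fin k)), IsNSeparating n F ∧ F.card = minSepSize n k := by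
  have h : {m : ℕ | ∃ F : Finset (Finset (Fin k)),
      IsNSeparating n F ∧ F.card = m}.Nonempty := by
    refine ⟨_, Finset.univ, ?_, rfl⟩
    intro B hB
    obtain ⟨A, hA⟩ := hB.2
    exact ⟨A, Finset.mem_univ A, hA⟩
  exact Nat.sInf_mem h

theorem minSepSize_le_card {n k : ℕ} (F : Finset (Finset (Fin k))) (hF : IsNSeparating n F) :
    minSepSize n k ≤ F.card :=
  Nat.sInf_le ⟨F, hF, rfl⟩

/-! A random cherry `x; y, z` (two edges sharing `x`) is cut by a fixed set with probability at most
about 1/4, so by averaging some cherry is cut by only about a quarter of any family. Iterating on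
disjoint cherries fixes `2 * r` pairs, about `n` of them, that only a fraction of about `4⁻ʳ` of `F`
separates (`exists_rarely_separated_pairs`). These survivors must still distinguish all unused
points (`IsNSeparating.exists_separates_distinguishes`), so they number at least the logarithm of
the count of unused points. Disjoint edges would cost two points per pair and could exhaust `k = 2 *
n`. Cherries cost 3/2, so more than `k / 4` points remain and the accumulated error factors stay
bounded. -/

open Finset in
/-- The cherries `x; y, z` inside `V` both of whose edges `xy`, `xz` are cut by `A`, counted. -/
theorem sum_card_cut_cherries {α : Type*} [DecidableEq α] (V A : Finset α) :
    ∑ x ∈ V, #{p ∈ (V.erase x).offDiag | (x ∈ A ↔ p.1 ∉ A) ∧ (x ∈ A ↔ p.2 ∉ A)} =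
      #(V ∩ A) * #(V \ A) * (#V - 2) := by
  have hin : ∀ x ∈ V ∩ A,
      #{p ∈ (V.erase x).offDiag | (x ∈ A ↔ p.1 ∉ A) ∧ (x ∈ A ↔ p.2 ∉ A)} =
        #(V \ A) * (#(V \ A) - 1) := by
    intro x hx
    rw [Nat.mul_sub_one, ← offDiag_card]
    congr 1
    ext ⟨y, z⟩
    simp only [mem_filter, mem_offDiag, mem_erase, mem_sdiff]
    rw [mem_inter] at hx
    grind
  have hout : ∀ x ∈ V \ A,
      #{p ∈ (V.erase x).offDiag | (x ∈ A ↔ p.1 ∉ A) ∧ (x ∈ A ↔ p.2 ∉ A)} =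
        #(V ∩ A) * (#(V ∩ A) - 1) := by
    intro x hx
    rw [Nat.mul_sub_one, ← offDiag_card]
    congr 1
    ext ⟨y, z⟩
    simp only [mem_filter, mem_offDiag, mem_erase, mem_inter]
    rw [mem_sdiff] at hx
    grind
  have hcard : #(V ∩ A) + #(V \ A) = #V := card_inter_add_card_sdiff V A
  rw [← sum_inter_add_sum_sdiff V A, sum_congr rfl hin, sum_congr rfl hout, sum_const, sum_const,
    smul_eq_mul, smul_eq_mul, ← hcard]
  -- The identity is `ab(b-1) + ba(a-1) = ab(a+b-2)`; empty sides are split off because subtraction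
  -- is truncated.
  rcases Nat.eq_zero_or_pos #(V ∩ A) with ha | ha
  · simp [ha]
  rcases Nat.eq_zero_or_pos #(V \ A) with hb | hb
  · simp [hb]
  obtain ⟨a, ha⟩ := Nat.exists_eq_add_of_lt ha
  obtain ⟨b, hb⟩ := Nat.exists_eq_add_of_lt hb
  rw [ha, hb, show 0 + a + 1 + (0 + b + 1) - 2 = a + b by omega]
  simp only [Nat.add_sub_cancel]
  ring

open Finset in
/-- Some cherry `x; y, z` in `V` has both its edges cut by at most a proportion
`|V| / (4 (|V| - 1))` of the family `G`. -/
theorem exists_cherry_rarely_cut {α : Type*} [DecidableEq α] (V : Finset α)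
    (G : Finset (Finset α)) (hV : 3 ≤ #V) :
    ∃ x ∈ V, ∃ y ∈ V, ∃ z ∈ V, x ≠ y ∧ x ≠ z ∧ y ≠ z ∧
      4 * (#V - 1) * #{A ∈ G | (x ∈ A ↔ y ∉ A) ∧ (x ∈ A ↔ z ∉ A)} ≤ #V * #G := by
  obtain ⟨m, hm⟩ : ∃ m, #V = m + 3 := ⟨#V - 3, by omega⟩
  let cut (x : α) (p : α × α) (A : Finset α) : Prop := (x ∈ A ↔ p.1 ∉ A) ∧ (x ∈ A ↔ p.2 ∉ A)
  -- Averaging over all ordered cherries: each `A` cuts `ab(a+b-2)` of them, and `4ab ≤ (a+b)^2`.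
  by_contra! hcon
  have hoff : ∀ x ∈ V, #(V.erase x).offDiag = (m + 2) * (m + 1) := by
    intro x hx
    rw [offDiag_card, card_erase_of_mem hx, hm, ← Nat.mul_sub_one]
    simp
  have hlow : ∑ x ∈ V, ∑ p ∈ (V.erase x).offDiag, #V * #G <
      ∑ x ∈ V, ∑ p ∈ (V.erase x).offDiag, 4 * (#V - 1) * #{A ∈ G | cut x p A} := by
    have hne : V.Nonempty := card_pos.mp (by omega)
    refine sum_lt_sum_of_nonempty hne fun x hx => sum_lt_sum_of_nonempty ?_ fun p hp => ?_
    · rw [← card_pos, hoff x hx]; positivity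
    · simp only [mem_offDiag, mem_erase] at hp
      exact hcon x hx p.1 hp.1.2 p.2 hp.2.1.2 (Ne.symm hp.1.1) (Ne.symm hp.2.1.1) hp.2.2
  have hswap : ∑ x ∈ V, ∑ p ∈ (V.erase x).offDiag, #{A ∈ G | cut x p A} =
      ∑ A ∈ G, #(V ∩ A) * #(V \ A) * (#V - 2) := by
    rw [← sum_congr rfl fun A _ => sum_card_cut_cherries V A, sum_comm (s := G)]
    refine sum_congr rfl fun x _ => ?_
    simp_rw [card_filter]
    exact sum_comm
  have hup : ∀ A ∈ G, 4 * (#(V ∩ A) * #(V \ A) * (#V - 2)) ≤ (m + 3) ^ 2 * (m + 1) := by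
    intro A _
    have hcard : #(V ∩ A) + #(V \ A) = m + 3 := hm ▸ card_inter_add_card_sdiff V A
    rw [hm, show m + 3 - 2 = m + 1 by omega, ← hcard, ← mul_assoc, ← mul_assoc]
    exact Nat.mul_le_mul_right _ (four_mul_le_sq_add _ _)
  have hsum := sum_le_sum hup
  rw [← mul_sum, ← hswap, sum_const, smul_eq_mul] at hsum
  simp_rw [← mul_sum, sum_const, smul_eq_mul] at hlow
  rw [sum_congr rfl fun x hx => by rw [hoff x hx], sum_const, smul_eq_mul, hm,
    show m + 3 - 1 = m + 2 by omega] at hlow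
  nlinarith [Nat.mul_le_mul_left (m + 2) hsum]

instance {k : ℕ} (A B : Finset (Fin k)) : Decidable (Separates A B) :=
  inferInstanceAs (Decidable (_ ∧ _))

theorem separates_pair_iff {k : ℕ} {A : Finset (Fin k)} {x y : Fin k} :
    Separates A {x, y} ↔ (x ∈ A ↔ y ∉ A) := by
  simp only [Separates, Finset.Nonempty, Finset.mem_inter, Finset.mem_insert,
    Finset.mem_singleton, Finset.mem_compl]
  grind

open Finset in
/-- Greedily choosing `r` disjoint cherries leaves at most a proportion of about `4⁻ʳ` of the
family `G` cutting all `2 r` edges. -/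
theorem exists_rarely_separated_pairs {k : ℕ} (s r : ℕ) (V : Finset (Fin k))
    (G : Finset (Finset (Fin k))) (hV : #V = s + 3 * r) :
    ∃ (P : List (Finset (Fin k))) (W A₀ : Finset (Fin k)),
      P.length = 2 * r ∧ W ⊆ V ∧ #W = s ∧ A₀ ⊆ V \ W ∧
      (∀ B ∈ P, #B = 2 ∧ B ⊆ V \ W ∧ Separates A₀ B) ∧
      (#{A ∈ G | ∀ B ∈ P, Separates A B} : ℝ) ≤ ((1 + 1 / (s + 2)) / 4) ^ r * #G := by
  induction r generalizing V G with
  | zero => exact ⟨[], V, ∅, by simp, subset_rfl, by simpa using hV, by simp, by simp, by simp⟩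
  | succ r ih =>
    obtain ⟨x, hx, y, hy, z, hz, hxy, hxz, hyz, hcut⟩ := exists_cherry_rarely_cut V G (by omega)
    set G' : Finset (Finset (Fin k)) := {A ∈ G | (x ∈ A ↔ y ∉ A) ∧ (x ∈ A ↔ z ∉ A)} with hG'
    have hT : #({x, y, z} : Finset (Fin k)) = 3 := card_eq_three.mpr ⟨x, y, z, hxy, hxz, hyz, rfl⟩
    have hTV : ({x, y, z} : Finset (Fin k)) ⊆ V := by
      intro t ht; simp only [mem_insert, mem_singleton] at ht; grind
    obtain ⟨P, W, A₀, hP, hWV, hW, hA₀, hB, hcard⟩ := ih (V \ {x, y, z}) G'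
      (by rw [card_sdiff_of_subset hTV, hT]; omega)
    have hmem : ∀ t ∈ W, t ∈ V ∧ t ≠ x ∧ t ≠ y ∧ t ≠ z := by
      intro t ht
      have := hWV ht
      simpa using this
    have hmem₀ : ∀ t ∈ A₀, (t ∈ V ∧ t ≠ x ∧ t ≠ y ∧ t ≠ z) ∧ t ∉ W := by
      intro t ht
      have := hA₀ ht
      simpa using this
    -- Putting only the centre `x` into `A₀` cuts both new edges and leaves the earlier pairs, which
    -- avoid `x`, unaffected.
    refine ⟨{x, y} :: {x, z} :: P, W, insert x A₀, by simp [hP]; ring,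
      hWV.trans sdiff_subset, hW, ?_, ?_, ?_⟩
    · intro t ht
      rw [mem_insert] at ht
      rw [mem_sdiff]
      grind
    · intro B hBP
      simp only [List.mem_cons] at hBP
      rcases hBP with rfl | rfl | hBP
      · refine ⟨card_pair hxy, ?_, ?_⟩
        · intro t ht
          simp only [mem_insert, mem_singleton] at ht
          rw [mem_sdiff]
          grind
        · rw [separates_pair_iff, mem_insert, mem_insert]
          grind
      · refine ⟨card_pair hxz, ?_, ?_⟩
        · intro t ht
          simp only [mem_insert, mem_singleton] at ht
          rw [mem_sdiff]
          grind
        · rw [separates_pair_iff, mem_insert, mem_insert]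
          grind
      · obtain ⟨h2, hsub, ⟨a, ha⟩, b, hb⟩ := hB B hBP
        refine ⟨h2, hsub.trans (sdiff_subset_sdiff sdiff_subset subset_rfl), ⟨a, ?_⟩, b, ?_⟩
        · rw [mem_inter] at ha ⊢
          exact ⟨mem_insert_of_mem ha.1, ha.2⟩
        · rw [mem_inter, mem_compl] at hb ⊢
          have := hsub hb.2
          simp only [mem_sdiff, mem_insert, mem_singleton, not_or] at this
          rw [mem_insert, not_or]
          exact ⟨⟨this.1.2.1, hb.1⟩, hb.2⟩
    · have hfilter : ({A ∈ G | ∀ B ∈ {x, y} :: {x, z} :: P, Separates A B} :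
          Finset (Finset (Fin k))) = {A ∈ G' | ∀ B ∈ P, Separates A B} := by
        ext A
        simp only [hG', mem_filter, List.forall_mem_cons, separates_pair_iff, and_assoc]
      rw [hfilter]
      have hstep : (#G' : ℝ) ≤ (1 + 1 / (s + 2)) / 4 * #G := by
        have hcut' : 4 * ((s : ℝ) + 3 * r + 2) * #G' ≤ (s + 3 * r + 3) * #G := by
          have h1 : #V - 1 = s + 3 * r + 2 := by omega
          have h2 : #V = s + 3 * r + 3 := by omega
          rw [h1, h2] at hcut
          exact_mod_cast hcut
        have hpos : (0 : ℝ) < s + 3 * r + 2 := by positivity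
        have hfrac : (1 : ℝ) / (s + 3 * r + 2) ≤ 1 / (s + 2) :=
          one_div_le_one_div_of_le (by positivity) (by linarith [r.cast_nonneg (α := ℝ)])
        calc (#G' : ℝ) ≤ (1 + 1 / (s + 3 * r + 2)) / 4 * #G := by
              rw [show (1 + 1 / ((s : ℝ) + 3 * r + 2)) / 4 * #G =
                (s + 3 * r + 3) * #G / (4 * (s + 3 * r + 2)) by field_simp; ring]
              rw [le_div_iff₀ (by positivity)]
              linarith
          _ ≤ _ := by gcongr
      calc _ ≤ ((1 + 1 / ((s : ℝ) + 2)) / 4) ^ r * #G' := hcard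
        _ ≤ ((1 + 1 / ((s : ℝ) + 2)) / 4) ^ r * ((1 + 1 / (s + 2)) / 4 * #G) := by gcongr
        _ = _ := by ring

open Finset in
/-- A family distinguishing all points of `W` has at least `log₂ |W|` members. -/
theorem card_le_two_pow_of_distinguishes {α : Type*} [DecidableEq α] (W : Finset α)
    (H : Finset (Finset α))
    (h : ∀ x ∈ W, ∀ y ∈ W, x ≠ y → ∃ A ∈ H, (x ∈ A ↔ y ∉ A)) : #W ≤ 2 ^ #H := by
  rw [← card_powerset]
  refine card_le_card_of_injOn (fun x => {A ∈ H | x ∈ A}) (fun x _ => ?_) fun x hx y hy hxy => ?_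
  · exact mem_powerset.mpr (filter_subset _ _)
  · by_contra hne
    obtain ⟨A, hA, hiff⟩ := h x hx y hy hne
    have := congrArg (A ∈ ·) hxy
    simp only [mem_filter, hA, true_and, eq_iff_iff] at this
    tauto

open Finset in
/-- If the first sets of a separable collection are fixed, the members of an `n`-separating family
that separate them distinguish all points outside. -/
theorem IsNSeparating.exists_separates_distinguishes {n k : ℕ} {F : Finset (Finset (Fin k))}
    (hF : IsNSeparating n F) {P : List (Finset (Fin k))} {W A₀ : Finset (Fin k)}
    (hn : P.length < n) (hA₀ : Disjoint A₀ W)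
    (hP : ∀ B ∈ P, #B = 2 ∧ Disjoint B W ∧ Separates A₀ B) {x y : Fin k} (hx : x ∈ W)
    (hy : y ∈ W) (hxy : x ≠ y) :
    ∃ A ∈ F, (∀ B ∈ P, Separates A B) ∧ (x ∈ A ↔ y ∉ A) := by
  -- Adding `x` is harmless since every `B` avoids `W`; it splits `{x, y}` because `y ∉ A₀`.
  have hsep : ∀ B ∈ P, Separates (insert x A₀) B := by
    intro B hB
    obtain ⟨-, hdis, ⟨a, ha⟩, b, hb⟩ := hP B hB
    rw [mem_inter] at ha
    rw [mem_inter, mem_compl] at hb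
    refine ⟨⟨a, mem_inter.mpr ⟨mem_insert_of_mem ha.1, ha.2⟩⟩, b, ?_⟩
    rw [mem_inter, mem_compl, mem_insert, not_or]
    exact ⟨⟨fun h => disjoint_left.mp hdis hb.2 (h ▸ hx), hb.1⟩, hb.2⟩
  have hsep' : Separates (insert x A₀) {x, y} := by
    rw [separates_pair_iff]
    have := disjoint_right.mp hA₀ hy
    grind
  -- The default `{x, y}` pads `P` to exactly `n` sets; it occurs at least once, at index `P.length
  -- < n`.
  have hcases : ∀ i, P.getD i {x, y} ∈ P ∨ P.getD i {x, y} = {x, y} := by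
    intro i
    rcases lt_or_ge i P.length with hi | hi
    · left
      rw [List.getD_eq_getElem _ _ hi]
      exact List.getElem_mem hi
    · right
      exact List.getD_eq_default _ _ hi
  obtain ⟨A, hA, hAB⟩ := hF (fun i => P.getD i {x, y}) ⟨fun i => by
      rcases hcases i with h | h
      · exact (hP _ h).1.ge
      · simp only [h, card_pair hxy, le_refl], insert x A₀, fun i => by
      rcases hcases i with h | h
      · exact hsep _ h
      · simpa only [h] using hsep'⟩
  refine ⟨A, hA, fun B hB => ?_, ?_⟩
  · obtain ⟨i, hi, rfl⟩ := List.getElem_of_mem hB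
    have := hAB ⟨i, hi.trans hn⟩
    rwa [List.getD_eq_getElem _ _ hi] at this
  · have := hAB ⟨P.length, hn⟩
    rwa [List.getD_eq_default _ _ le_rfl, separates_pair_iff] at this

open Finset in
theorem IsNSeparating.le_card {n k : ℕ} {F : Finset (Finset (Fin k))} (hF : IsNSeparating n F)
    (hn : 1 ≤ n) (hk : 2 * n ≤ k) : 1 / 24 * (2 ^ n * Real.logb 2 k) ≤ (#F : ℝ) := by
  -- The largest `r` with `2 * r + 1 ≤ n`: one set is kept for the pair to be distinguished.
  obtain ⟨r, hr⟩ : ∃ r, r = (n - 1) / 2 := ⟨_, rfl⟩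
  obtain ⟨s, hs⟩ : ∃ s, k = s + 3 * r := ⟨k - 3 * r, by omega⟩
  obtain ⟨P, W, A₀, hlen, -, hW, hA₀, hP, hcard⟩ :=
    exists_rarely_separated_pairs s r univ F (by simpa using hs)
  set H : Finset (Finset (Fin k)) := {A ∈ F | ∀ B ∈ P, Separates A B}
  have hWH : s ≤ 2 ^ #H := hW ▸ card_le_two_pow_of_distinguishes W H fun x hx y hy hxy => by
    obtain ⟨A, hA, hAP, hAxy⟩ := hF.exists_separates_distinguishes (by omega)
      (disjoint_sdiff_self_left.mono_left hA₀)
      (fun B hB => ⟨(hP B hB).1, disjoint_sdiff_self_left.mono_left (hP B hB).2.1,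
        (hP B hB).2.2⟩) hx hy hxy
    exact ⟨A, mem_filter.mpr ⟨hA, hAP⟩, hAxy⟩
  have hlog : Real.logb 2 k ≤ 2 * #H := by
    -- `6 * r ≤ 3 * (n - 1)` and `2 * n ≤ k` give `k ≤ 4 * s - 6`, which is below `s ^ 2`.
    have hks : (k : ℝ) ≤ (s : ℝ) ^ 2 := by
      have : (k : ℝ) + 6 ≤ 4 * s := by exact_mod_cast (by omega : k + 6 ≤ 4 * s)
      nlinarith [sq_nonneg ((s : ℝ) - 2)]
    have hsH : (s : ℝ) ≤ 2 ^ #H := by exact_mod_cast hWH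
    have hk0 : (0 : ℝ) < k := by exact_mod_cast (by omega : 0 < k)
    calc Real.logb 2 k ≤ Real.logb 2 (((2 : ℝ) ^ #H) ^ 2) :=
          Real.logb_le_logb_of_le one_lt_two hk0 (hks.trans (by gcongr))
      _ = 2 * #H := by
          rw [Real.logb_pow, Real.logb_pow, Real.logb_self_eq_one one_lt_two]; push_cast; ring
  have hexp : (1 + 1 / ((s : ℝ) + 2)) ^ r ≤ 3 := by
    have hrs : (r : ℝ) ≤ s := by exact_mod_cast (by omega : r ≤ s)
    calc (1 + 1 / ((s : ℝ) + 2)) ^ r ≤ Real.exp (1 / ((s : ℝ) + 2)) ^ r := by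
          gcongr
          linarith [Real.add_one_le_exp (1 / ((s : ℝ) + 2))]
      _ = Real.exp (r / (s + 2)) := by rw [← Real.exp_nat_mul]; congr 1; ring
      _ ≤ Real.exp 1 := by
          gcongr
          rw [div_le_one (by positivity)]
          linarith
      _ ≤ 3 := by linarith [Real.exp_one_lt_d9]
  have hlog0 : 0 ≤ Real.logb 2 (k : ℝ) :=
    Real.logb_nonneg one_lt_two (by exact_mod_cast (by omega : 1 ≤ k))
  have hpow : (2 : ℝ) ^ n ≤ 4 * 4 ^ r := by
    calc (2 : ℝ) ^ n ≤ 2 ^ (2 * r + 2) := pow_le_pow_right₀ one_le_two (by omega)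
      _ = 4 * 4 ^ r := by rw [pow_add, pow_mul]; norm_num; ring
  have hHF : (4 : ℝ) ^ r * #H ≤ 3 * #F := by
    calc (4 : ℝ) ^ r * #H ≤ 4 ^ r * (((1 + 1 / (s + 2)) / 4) ^ r * #F) := by gcongr
      _ = (1 + 1 / ((s : ℝ) + 2)) ^ r * #F := by rw [div_pow]; field_simp
      _ ≤ 3 * #F := by gcongr
  -- 24 = 4 · 2 · 3: rounding in `r`, passing from `s` to `k`, and the bound `e ≤ 3` on the error
  -- factors.
  calc 1 / 24 * (2 ^ n * Real.logb 2 k) ≤ 1 / 24 * (4 * 4 ^ r * (2 * #H)) := by gcongr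
    _ = 1 / 3 * (4 ^ r * #H) := by ring
    _ ≤ #F := by linarith

theorem mainTheorem2 :
    ∃ c : ℝ, 0 < c ∧ ∀ n k : ℕ, 1 ≤ n → 2 * n ≤ k →
      c * (2 ^ n * Real.logb 2 (k : ℝ)) ≤ (minSepSize n k : ℝ) := by
  refine ⟨1 / 24, by norm_num, fun n k hn hk => ?_⟩
  obtain ⟨F, hF, hcard⟩ := exists_card_eq_minSepSize n k
  exact hcard ▸ hF.le_card hn hk
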